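/- A system $(X,T)$ is a compact metric space $X$ with a homeomorphism $T:X\to X$. It is minimal if $X\neq\emptyset$ and every orbit $\{T^nx:n\in\mathbb Z\}$ is dense, and equicontinuous if the family $\{T^n\}_{n\in\mathbb Z}$ is uniformly equicontinuous. A factor map $(X,T)\to(W,R)$ is a continuous surjection $\varphi$ with $\varphi T=R\varphi$. A minimal subset of a system is a nonempty closed invariant set in which the orbit of each of its points is dense. A joining of $(X,T)$ and $(Y,S)$ is a closed $T\times S$-invariant subset of $X\times Y$ that projects onto $X$ and onto $Y$. Let $\pi_X:X\to X_{eq}$ denote the maximal equicontinuous factor of $(X,T)$, that is, the quotient of $X$ by the relation that identifies two points when every factor map from $(X,T)$ onto an equicontinuous system identifies them. Minimal systems $(X,T)$ and $(Y,S)$ are quasi-disjoint, written $X\perp_Q Y$, if $X\times Y$ is the only joining $J$ with $(\pi_X\times\pi_Y)(J)=X_{eq}\times Y_{eq}$. A maximal common equicontinuous factor of $(X,T)$ and $(Y,S)$ is an equicontinuous system $(Z,R)$ with factor maps $\alpha:X\to Z$, $\beta:Y\to Z$ such that for all factor maps $\varphi:X\to W$, $\psi:Y\to W$ onto an equicontinuous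 system $(W,Q)$ there are factor maps $\eta_1,\eta_2:Z\to W$ with $\varphi=\eta_1\alpha$ and $\psi=\eta_2\beta$. **Theorem.** Let $(X,T)$ and $(Y,S)$ be minimal systems. They have a maximal common equicontinuous factor $Eq(X,Y)$, with factor maps $\alpha:X\to Eq(X,Y)$ and $\beta:Y\to Eq(X,Y)$, that is a translation $z\mapsto z+\theta$ on a compact metrizable abelian group. For every such realization, put $\gamma:X\times Y\to Eq(X,Y)$, $\gamma(x,y)=\alpha(x)-\beta(y)$. Then the following are equivalent: 1. There is a point $z\in Eq(X,Y)$ such that $\gamma^{-1}(z)$ contains a unique minimal subset of $(X\times Y,T\times S)$. 2. There is a dense $G_\delta$ subset $\Omega\subset Eq(X,Y)$ such that for each $z\in\Omega$, $\gamma^{-1}(z)$ contains a unique minimal subset of $(X\times Y,T\times S)$. 3. $X\perp_Q Y$. -/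

import Mathlib

universe u

namespace TopDyn

/-- The system `(X, T)` is minimal: `X` is nonempty and the two-sided orbit of every point is
dense. (`T ^ n` is the iterate in the group of self-homeomorphisms of `X`.) -/
def IsMinimalSystem {X : Type u} [TopologicalSpace X] (T : X ≃ₜ X) : Prop :=
  Nonempty X ∧ ∀ x : X, Dense (Set.range fun n : ℤ => (T ^ n) x)

/-- The system `(X, T)` is equicontinuous: for every `ε > 0` there is `δ > 0` such that
`dist x y < δ` implies `dist (T ^ n x) (T ^ n y) < ε` for every integer `n`. -/
def IsEquicontinuousSystem {X : Type u} [MetricSpace X] (T : X ≃ₜ X) : Prop :=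
  UniformEquicontinuous fun n : ℤ => ((T ^ n : X ≃ₜ X) : X → X)

/-- `φ` is a factor map (homomorphism) from `(X, T)` onto `(W, R)`. -/
structure IsFactorMap {X W : Type u} [TopologicalSpace X] [TopologicalSpace W]
    (T : X ≃ₜ X) (R : W ≃ₜ W) (φ : X → W) : Prop where
  continuous : Continuous φ
  surjective : Function.Surjective φ
  semiconj : Function.Semiconj φ T R

/-- The equicontinuous structure relation of `(X, T)`: two points are related when they are
identified by every factor map onto an equicontinuous system. -/
def equicontinuousSetoid {X : Type u} [MetricSpace X] (T : X ≃ₜ X) : Setoid X where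
  r x x' := ∀ (W : Type u) [MetricSpace W] [CompactSpace W] (R : W ≃ₜ W) (φ : X → W),
    IsEquicontinuousSystem R → IsFactorMap T R φ → φ x = φ x'
  iseqv :=
    { refl := fun _ _ _ _ _ _ _ _ => rfl
      symm := fun h W _ _ R φ hR hφ => (h W R φ hR hφ).symm
      trans := fun h h' W _ _ R φ hR hφ => (h W R φ hR hφ).trans (h' W R φ hR hφ) }

/-- The space `X_eq` of the maximal equicontinuous factor of `(X, T)`. -/
abbrev MaxEquicontinuousFactor {X : Type u} [MetricSpace X] (T : X ≃ₜ X) : Type u :=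
  Quotient (equicontinuousSetoid T)

/-- The projection `π_X : X → X_eq` onto the maximal equicontinuous factor. -/
def maxEquicontinuousProj {X : Type u} [MetricSpace X] (T : X ≃ₜ X) :
    X → MaxEquicontinuousFactor T :=
  Quotient.mk (equicontinuousSetoid T)

/-- The system `(Z, R)`, with the factor maps `α : X → Z` and `β : Y → Z`, is a maximal common
equicontinuous factor of `(X, T)` and `(Y, S)`: it is a common equicontinuous factor, and any
common equicontinuous factor `(W, Q)`, with `φ : X → W` and `ψ : Y → W`, is a factor of it through
some `η₁`, `η₂` with `φ = η₁ ∘ α` and `ψ = η₂ ∘ β`. -/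
structure IsMaxCommonEquicontinuousFactor {X Y Z : Type u} [MetricSpace X] [MetricSpace Y]
    [MetricSpace Z] (T : X ≃ₜ X) (S : Y ≃ₜ Y) (R : Z ≃ₜ Z) (α : X → Z) (β : Y → Z) : Prop where
  equicontinuous : IsEquicontinuousSystem R
  left : IsFactorMap T R α
  right : IsFactorMap S R β
  maximal : ∀ (W : Type u) [MetricSpace W] [CompactSpace W] (Q : W ≃ₜ W) (φ : X → W) (ψ : Y → W),
    IsEquicontinuousSystem Q → IsFactorMap T Q φ → IsFactorMap S Q ψ →
      ∃ η₁ η₂ : Z → W, IsFactorMap R Q η₁ ∧ IsFactorMap R Q η₂ ∧ φ = η₁ ∘ α ∧ ψ = η₂ ∘ β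

/-- `M` is a minimal subset of the system `(X, F)`: a nonempty closed invariant set in which the
orbit of every one of its points is dense. -/
structure IsMinimalSubset {X : Type u} [TopologicalSpace X] (F : X ≃ₜ X) (M : Set X) : Prop where
  nonempty : M.Nonempty
  isClosed : IsClosed M
  invariant : F '' M = M
  dense_orbit : ∀ p ∈ M, M ⊆ closure (Set.range fun n : ℤ => (F ^ n) p)

/-- The set `A` contains exactly one minimal subset of the system `(X, F)`. -/
def HasUniqueMinimalSubset {X : Type u} [TopologicalSpace X] (F : X ≃ₜ X) (A : Set X) : Prop :=
  ∃! M : Set X, M ⊆ A ∧ IsMinimalSubset F M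

/-- `J` is a joining of `(X, T)` and `(Y, S)`: a closed `T × S`-invariant subset of `X × Y` that
projects onto `X` and onto `Y`. -/
structure IsJoining {X Y : Type u} [TopologicalSpace X] [TopologicalSpace Y]
    (T : X ≃ₜ X) (S : Y ≃ₜ Y) (J : Set (X × Y)) : Prop where
  isClosed : IsClosed J
  invariant : T.prodCongr S '' J = J
  fst_image : Prod.fst '' J = Set.univ
  snd_image : Prod.snd '' J = Set.univ

/-- Quasi-disjointness `X ⊥_Q Y`: the only joining of `(X, T)` and `(Y, S)` whose image under
`π_X × π_Y` is `X_eq × Y_eq` is `X × Y`. -/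
def QuasiDisjoint {X Y : Type u} [MetricSpace X] [MetricSpace Y]
    (T : X ≃ₜ X) (S : Y ≃ₜ Y) : Prop :=
  ∀ J : Set (X × Y), IsJoining T S J →
    Prod.map (maxEquicontinuousProj T) (maxEquicontinuousProj S) '' J = Set.univ →
      J = Set.univ

end TopDyn

namespace TopDyn

/-! ### Integer iterates, orbit closures and minimal sets. -/

section Basic

variable {X W : Type u} [TopologicalSpace X] [TopologicalSpace W]

/-! The map `γ(x, y) = α x - β y` is constant on `T × S`-orbits, while `T ^ m × S ^ n` carries its
fiber over `z` to the fiber over `z + (m - n) • θ`.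

If the fiber over `z` has a unique minimal subset `M`, and a joining `J` projects onto `X_eq ×
Y_eq`, then `J` meets every fiber of `γ`. A minimal subset of `J` over `z + (m - n) • θ`, moved back
by `T ^ (-m) × S ^ (-n)`, must be `M`. Hence `J` contains every `(T ^ m × S ^ n) M`, and the union
of these is dense (`quasiDisjoint_of_hasUniqueMinimalSubset`).

Conversely, for a nonempty open `U` the points whose orbits avoid `U` form a closed invariant set.
If it met every fiber of `γ`, it would project onto `X_eq × Y_eq` and, by quasi-disjointness, be
everything. So some fiber has all its orbits meeting `U`; a Baire argument over a countable basis
makes generic fibers minimal (`QuasiDisjoint.exists_isGδ_dense`).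

The structural input is that `X_eq` and `Y_eq` are rotations by `a`, `b` on compact abelian groups
`G`, `H`, and that the maximal common factor is `G × H` modulo the closed subgroup generated by `(a,
b)`. In any realization, a fiber of `γ` lies over a single coset (`sub_mem_diagonalClosure`), so a
closed invariant set meeting every fiber covers `G × H` (`image_proj_eq_univ`). -/

theorem zpow_add_apply (F : X ≃ₜ X) (m n : ℤ) (x : X) : (F ^ (m + n)) x = (F ^ m) ((F ^ n) x) := by
  rw [zpow_add]; rfl

theorem zpow_add_one_apply (F : X ≃ₜ X) (n : ℤ) (x : X) : (F ^ (n + 1)) x = F ((F ^ n) x) := by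
  rw [add_comm, zpow_add_apply, zpow_one]

theorem zpow_zpow_neg_apply (F : X ≃ₜ X) (n : ℤ) (x : X) : (F ^ n) ((F ^ (-n)) x) = x := by
  rw [← zpow_add_apply, add_neg_cancel, zpow_zero]; rfl

theorem semiconj_zpow {T : X ≃ₜ X} {R : W ≃ₜ W} {φ : X → W} (h : Function.Semiconj φ T R)
    (n : ℤ) (x : X) : φ ((T ^ n) x) = (R ^ n) (φ x) := by
  induction n with
  | zero => rfl
  | succ n ih => rw [zpow_add_one_apply, zpow_add_one_apply, h, ih]
  | pred n ih =>
    apply R.injective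
    rw [← h, ← zpow_add_one_apply, ← zpow_add_one_apply, sub_add_cancel, ih]

theorem prodCongr_zpow_apply {Y : Type u} [TopologicalSpace Y] (T : X ≃ₜ X) (S : Y ≃ₜ Y) (n : ℤ)
    (p : X × Y) : ((T.prodCongr S) ^ n) p = ((T ^ n) p.1, (S ^ n) p.2) := by
  refine Prod.ext ?_ ?_
  · exact semiconj_zpow (T := T.prodCongr S) (R := T) (φ := Prod.fst) (fun _ => rfl) n p
  · exact semiconj_zpow (T := T.prodCongr S) (R := S) (φ := Prod.snd) (fun _ => rfl) n p

theorem addRight_zpow_apply {Z : Type u} [TopologicalSpace Z] [AddCommGroup Z]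
    [IsTopologicalAddGroup Z] (θ : Z) (n : ℤ) (z : Z) :
    ((Homeomorph.addRight θ) ^ n) z = z + n • θ := by
  induction n with
  | zero => simp
  | succ n ih => rw [zpow_add_one_apply, ih, add_zsmul]; simp [add_assoc]
  | pred n ih =>
    apply (Homeomorph.addRight θ).injective
    rw [← zpow_add_one_apply, sub_add_cancel, ih, sub_zsmul]
    simp [add_assoc]

theorem zpow_mem {F : X ≃ₜ X} {M : Set X} (h : F '' M = M) (n : ℤ) {x : X} (hx : x ∈ M) :
    (F ^ n) x ∈ M := by
  induction n with
  | zero => exact hx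
  | succ n ih => rw [zpow_add_one_apply, ← h]; exact Set.mem_image_of_mem _ ih
  | pred n ih =>
    rw [← h] at ih
    obtain ⟨y, hy, hyx⟩ := ih
    rw [show -(n : ℤ) = (-(n : ℤ) - 1) + 1 by ring, zpow_add_one_apply] at hyx
    rwa [← F.injective hyx]

theorem image_eq_of_zpow_mem {F : X ≃ₜ X} {M : Set X} (h : ∀ (n : ℤ), ∀ x ∈ M, (F ^ n) x ∈ M) :
    F '' M = M := by
  apply Set.Subset.antisymm
  · rintro _ ⟨x, hx, rfl⟩
    simpa using h 1 x hx
  · intro x hx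
    exact ⟨(F ^ (-1 : ℤ)) x, h _ x hx, by simp⟩

/-- The closure of the orbit of `x` under `F`. -/
def orbitClosure (F : X ≃ₜ X) (x : X) : Set X := closure (Set.range fun n : ℤ => (F ^ n) x)

theorem self_mem_orbitClosure (F : X ≃ₜ X) (x : X) : x ∈ orbitClosure F x :=
  subset_closure ⟨0, rfl⟩

theorem image_orbitClosure (F : X ≃ₜ X) (x : X) : F '' orbitClosure F x = orbitClosure F x := by
  rw [orbitClosure, F.image_closure, ← Set.range_comp]
  congr 1
  apply Set.Subset.antisymm
  · rintro _ ⟨n, rfl⟩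
    exact ⟨n + 1, zpow_add_one_apply F n x⟩
  · rintro _ ⟨n, rfl⟩
    refine ⟨n - 1, ?_⟩
    simp only [Function.comp]
    rw [← zpow_add_one_apply, sub_add_cancel]

theorem orbitClosure_subset {F : X ≃ₜ X} {M : Set X} (hc : IsClosed M) (h : F '' M = M) {x : X}
    (hx : x ∈ M) : orbitClosure F x ⊆ M :=
  closure_minimal (by rintro _ ⟨n, rfl⟩; exact zpow_mem h n hx) hc

theorem IsMinimalSystem.eq_univ {T : X ≃ₜ X} (hT : IsMinimalSystem T) {M : Set X}
    (hc : IsClosed M) (h : T '' M = M) (hne : M.Nonempty) : M = Set.univ := by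
  obtain ⟨x, hx⟩ := hne
  apply Set.eq_univ_of_univ_subset
  rw [← (hT.2 x).closure_eq]
  exact orbitClosure_subset hc h hx

theorem IsMinimalSystem.factor {T : X ≃ₜ X} {R : W ≃ₜ W} {φ : X → W} (hT : IsMinimalSystem T)
    (hφ : IsFactorMap T R φ) : IsMinimalSystem R := by
  refine ⟨hT.1.map φ, fun w => ?_⟩
  obtain ⟨x, rfl⟩ := hφ.surjective w
  have := hφ.surjective.denseRange.dense_image hφ.continuous (hT.2 x)
  rw [← Set.range_comp] at this
  convert this using 3 with n
  exact (semiconj_zpow hφ.semiconj n x).symm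

theorem IsFactorMap.comp {V : Type u} [TopologicalSpace V] {T : X ≃ₜ X} {R : W ≃ₜ W} {Q : V ≃ₜ V}
    {ψ : W → V} {φ : X → W} (hψ : IsFactorMap R Q ψ) (hφ : IsFactorMap T R φ) :
    IsFactorMap T Q (ψ ∘ φ) :=
  ⟨hψ.continuous.comp hφ.continuous, hψ.surjective.comp hφ.surjective,
    hφ.semiconj.trans hψ.semiconj⟩

/-- Zorn's lemma, with compactness keeping intersections of chains nonempty. A minimal element has
no smaller closed invariant set, so it lies in the orbit closure of each of its points. -/
theorem exists_isMinimalSubset [CompactSpace X] (F : X ≃ₜ X) {A : Set X} (hc : IsClosed A)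
    (hi : F '' A = A) (hne : A.Nonempty) : ∃ M ⊆ A, IsMinimalSubset F M := by
  obtain ⟨M, hMA, hM⟩ := zorn_superset_nonempty
    {B : Set X | IsClosed B ∧ F '' B = B ∧ B.Nonempty} (fun c hcS hch hcne => by
      refine ⟨⋂₀ c, ⟨isClosed_sInter fun B hB => (hcS hB).1, ?_, ?_⟩,
        fun B hB => Set.sInter_subset_of_mem hB⟩
      · exact image_eq_of_zpow_mem fun n x hx B hB => zpow_mem (hcS hB).2.1 n (hx B hB)
      · have := hcne.to_subtype
        refine IsCompact.nonempty_sInter_of_directed_nonempty_isCompact_isClosed ?_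
          (fun B hB => (hcS hB).2.2) (fun B hB => (hcS hB).1.isCompact) fun B hB => (hcS hB).1
        exact fun B hB C hC => (hch.total hB hC).elim (fun h => ⟨B, hB, subset_rfl, h⟩)
          fun h => ⟨C, hC, h, subset_rfl⟩) A ⟨hc, hi, hne⟩
  refine ⟨M, hMA, hM.prop.2.2, hM.prop.1, hM.prop.2.1, fun p hp => ?_⟩
  exact hM.le_of_le (y := orbitClosure F p)
    ⟨isClosed_closure, image_orbitClosure F p, p, self_mem_orbitClosure F p⟩
    (orbitClosure_subset hM.prop.1 hM.prop.2.1 hp)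

end Basic

/-! ### Minimal equicontinuous systems as group rotations. -/

section GroupStructure

variable {W : Type u} [MetricSpace W]

/-- The integers, regarded as indexing the orbit of the point `e` under `R`. -/
def OrbitIndex (_R : W ≃ₜ W) (_e : W) : Type := ℤ

namespace OrbitIndex

variable (R : W ≃ₜ W) (e : W)

instance : AddCommGroup (OrbitIndex R e) := inferInstanceAs (AddCommGroup ℤ)

/-- The index of the image of the base point. -/
def one : OrbitIndex R e := (1 : ℤ)

/-- The point of the orbit with a given index. -/
def toPoint (n : OrbitIndex R e) : W := (R ^ (show ℤ from n)) e

noncomputable instance : PseudoMetricSpace (OrbitIndex R e) :=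
  PseudoMetricSpace.induced (toPoint R e) inferInstance

theorem toPoint_add (m n : OrbitIndex R e) :
    toPoint R e (m + n) = (R ^ (show ℤ from m)) (toPoint R e n) :=
  zpow_add_apply R _ _ e

theorem isUniformInducing_toPoint : IsUniformInducing (toPoint R e) := ⟨rfl⟩

-- The metric pulled back from the orbit need not be translation invariant, but equicontinuity makes
-- all translations equicontinuous with a common modulus, which suffices.
variable {R} in
theorem isUniformAddGroup (hR : IsEquicontinuousSystem R) :
    IsUniformAddGroup (OrbitIndex R e) := by
  refine ⟨Metric.uniformContinuous_iff.2 fun ε hε => ?_⟩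
  obtain ⟨δ, hδ, h⟩ := Metric.uniformEquicontinuous_iff.1 hR (ε / 2) (half_pos hε)
  have key : ∀ k m n : OrbitIndex R e, dist m n < δ → dist (k + m) (k + n) < ε / 2 := by
    intro k m n hmn
    change dist (toPoint R e (k + m)) (toPoint R e (k + n)) < _
    rw [toPoint_add, toPoint_add]
    exact h _ _ hmn _
  refine ⟨δ, hδ, ?_⟩
  rintro ⟨m, n⟩ ⟨m', n'⟩ hd
  rw [Prod.dist_eq, max_lt_iff] at hd
  -- The intermediate point is `m' - n`. Translating by `m' - n - n'` exchanges the roles of `n` and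
  -- `n'`, which handles negation.
  have h1 := key (-n) m m' hd.1
  have h2 := key (m' - n - n') n n' hd.2
  rw [show -n + m = m - n by abel, show -n + m' = m' - n by abel] at h1
  rw [show m' - n - n' + n = m' - n' by abel, show m' - n - n' + n' = m' - n by abel,
    dist_comm] at h2
  calc dist (m - n) (m' - n') ≤ dist (m - n) (m' - n) + dist (m' - n) (m' - n') :=
        dist_triangle _ _ _
    _ < ε / 2 + ε / 2 := add_lt_add h1 h2
    _ = ε := add_halves ε

end OrbitIndex

/-- A minimal equicontinuous system is a rotation of a compact abelian group. -/
theorem exists_eq_addRight [CompactSpace W] {R : W ≃ₜ W} (hR : IsEquicontinuousSystem R)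
    (hm : IsMinimalSystem R) :
    ∃ (_ : AddCommGroup W) (_ : IsTopologicalAddGroup W) (a : W), R = Homeomorph.addRight a := by
  obtain ⟨e⟩ := hm.1
  have := OrbitIndex.isUniformAddGroup e hR
  have hdense : DenseRange (OrbitIndex.toPoint R e) := hm.2 e
  -- The dense orbit exhibits `W` as a completion of `ℤ`; the group law is transported from the
  -- canonical completion.
  let pkg : AbstractCompletion (OrbitIndex R e) :=
    { space := W
      coe := OrbitIndex.toPoint R e
      uniformStruct := inferInstance
      complete := inferInstance
      separation := inferInstance
      isUniformInducing := OrbitIndex.isUniformInducing_toPoint R e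
      dense := hdense }
  let E : UniformSpace.Completion (OrbitIndex R e) ≃ᵤ W :=
    UniformSpace.Completion.cPkg.compareEquiv pkg
  have hE : ∀ n : OrbitIndex R e, E (n : UniformSpace.Completion (OrbitIndex R e)) =
      OrbitIndex.toPoint R e n := fun n =>
    AbstractCompletion.compare_coe UniformSpace.Completion.cPkg pkg n
  let grp : AddCommGroup W := E.symm.toEquiv.addCommGroup
  have hadd : ∀ x y : W, x + y = E (E.symm x + E.symm y) := fun _ _ => rfl
  have hneg : ∀ x : W, -x = E (-E.symm x) := fun _ => rfl
  have htop : IsTopologicalAddGroup W :=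
    { continuous_add := by
        simp only [hadd]
        have h1 := E.continuous
        have h2 := E.symm.continuous
        fun_prop
      continuous_neg := by
        simp only [hneg]
        have h1 := E.continuous
        have h2 := E.symm.continuous
        fun_prop }
  refine ⟨grp, htop, E (OrbitIndex.one R e : UniformSpace.Completion (OrbitIndex R e)), ?_⟩
  have : (R : W → W) = Homeomorph.addRight
      (E (OrbitIndex.one R e : UniformSpace.Completion (OrbitIndex R e))) := by
    refine hdense.equalizer R.continuous (Homeomorph.continuous _) (funext fun n => ?_)
    simp only [Function.comp, Homeomorph.coe_addRight]
    rw [hadd, ← hE n, E.symm_apply_apply, E.symm_apply_apply, ← UniformSpace.Completion.coe_add,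
      hE, hE]
    exact (zpow_add_one_apply R _ e).symm
  exact Homeomorph.ext fun x => congrFun this x

/-- A rotation of a compact abelian group is equicontinuous, for any compatible metric. -/
theorem isEquicontinuousSystem_addRight [CompactSpace W] [AddCommGroup W]
    [IsTopologicalAddGroup W] (θ : W) : IsEquicontinuousSystem (Homeomorph.addRight θ) := by
  have huc : UniformContinuous fun p : W × W => p.1 + p.2 :=
    CompactSpace.uniformContinuous_of_continuous continuous_add
  refine Metric.uniformEquicontinuous_iff.2 fun ε hε => ?_
  obtain ⟨δ, hδ, h⟩ := Metric.uniformContinuous_iff.1 huc ε hε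
  refine ⟨δ, hδ, fun x y hxy n => ?_⟩
  rw [addRight_zpow_apply, addRight_zpow_apply]
  exact h (a := (x, n • θ)) (b := (y, n • θ)) (by simpa [Prod.dist_eq, hδ] using hxy)

end GroupStructure

/-! ### A metrizable model of the maximal equicontinuous factor. -/

section MaximalEquicontinuousFactor

-- The factor is the image of `X` in the product; countability keeps it metrizable, and
-- equicontinuity is checked coordinatewise.
open scoped PiCountable in
theorem exists_countable_product_factor {X : Type u} [MetricSpace X] [CompactSpace X] {T : X ≃ₜ X}
    {ι : Type u} [Countable ι] (W : ι → Type u) [∀ i, MetricSpace (W i)]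
    [∀ i, CompactSpace (W i)] (R : ∀ i, W i ≃ₜ W i) (φ : ∀ i, X → W i)
    (hR : ∀ i, IsEquicontinuousSystem (R i)) (hφ : ∀ i, IsFactorMap T (R i) (φ i)) :
    ∃ (G : Type u) (_ : MetricSpace G) (_ : CompactSpace G) (Q : G ≃ₜ G) (π : X → G),
      IsEquicontinuousSystem Q ∧ IsFactorMap T Q π ∧
        ∀ x x', π x = π x' → ∀ i, φ i x = φ i x' := by
  let := Encodable.ofCountable ι
  let : MetricSpace (∀ i, W i) := PiCountable.metricSpace
  let Φ : X → ∀ i, W i := fun x i => φ i x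
  have hΦ : Continuous Φ := continuous_pi fun i => (hφ i).continuous
  let P : (∀ i, W i) ≃ₜ (∀ i, W i) := Homeomorph.piCongrRight R
  have hsemi : Function.Semiconj Φ T P := fun x => funext fun i => (hφ i).semiconj x
  let Q : Set.range Φ ≃ₜ Set.range Φ := P.subtype fun w => by
    constructor
    · rintro ⟨x, rfl⟩
      exact ⟨T x, hsemi x⟩
    · rintro ⟨x, hx⟩
      refine ⟨T.symm x, P.injective ?_⟩
      rw [← hsemi, T.apply_symm_apply, hx]
  refine ⟨Set.range Φ, inferInstance, isCompact_iff_compactSpace.1 (isCompact_range hΦ), Q,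
    Set.rangeFactorization Φ, ?_, ⟨hΦ.subtype_mk _,
      Set.rangeFactorization_surjective, fun x => Subtype.ext (hsemi x)⟩,
    fun x x' h i => congrFun (congrArg Subtype.val h) i⟩
  · have hu : IsUniformInducing (Subtype.val : Set.range Φ → ∀ i, W i) := ⟨rfl⟩
    refine hu.uniformEquicontinuous_iff.2 ?_
    rw [Pi.uniformSpace_eq, uniformEquicontinuous_iInf_rng]
    intro i U hU
    obtain ⟨V, hV, hVU⟩ := hU
    have hQ : ∀ (n : ℤ) (w : Set.range Φ), ((Q ^ n) w).1 i = ((R i) ^ n) (w.1 i) := fun n w =>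
      semiconj_zpow (T := Q) (R := R i) (φ := fun w => w.1 i) (fun _ => rfl) n w
    have hc : UniformContinuous fun w : Set.range Φ => w.1 i :=
      (Pi.uniformContinuous_proj W i).comp hu.uniformContinuous
    filter_upwards [hc (hR i V hV)] with p hp n
    refine hVU ?_
    simpa [hQ] using hp n

/-- The unrelated pairs are covered by the open sets where some factor map separates coordinates. By
the Lindelöf property countably many factor maps suffice. -/
theorem exists_maximal_equicontinuous_factor {X : Type u} [MetricSpace X] [CompactSpace X]
    (T : X ≃ₜ X) :
    ∃ (G : Type u) (_ : MetricSpace G) (_ : CompactSpace G) (Q : G ≃ₜ G) (π : X → G),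
      IsEquicontinuousSystem Q ∧ IsFactorMap T Q π ∧
        ∀ x x', π x = π x' → equicontinuousSetoid T x x' := by
  let I := {p : X × X // ¬ equicontinuousSetoid T p.1 p.2}
  have hI : ∀ p : I, ∃ (W : Type u) (_ : MetricSpace W) (_ : CompactSpace W) (R : W ≃ₜ W)
      (φ : X → W), IsEquicontinuousSystem R ∧ IsFactorMap T R φ ∧ φ p.1.1 ≠ φ p.1.2 := by
    intro p
    have := p.2
    change ¬ ∀ (W : Type u) [MetricSpace W] [CompactSpace W] (R : W ≃ₜ W) (φ : X → W),
      IsEquicontinuousSystem R → IsFactorMap T R φ → φ p.1.1 = φ p.1.2 at this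
    push Not at this
    obtain ⟨W, i1, i2, R, φ, h1, h2, h3⟩ := this
    exact ⟨W, i1, i2, R, φ, h1, h2, h3⟩
  choose W i1 i2 R φ hR hφ hne using hI
  obtain ⟨C, hC, hCU⟩ := TopologicalSpace.isOpen_iUnion_countable
    (fun p : I => {q : X × X | φ p q.1 ≠ φ p q.2}) fun p => by
      have := (hφ p).continuous
      exact isOpen_ne_fun (by fun_prop) (by fun_prop)
  have : Countable C := hC.to_subtype
  obtain ⟨G, j1, j2, Q, π, hQ, hπ, h⟩ := exists_countable_product_factor (T := T)
    (fun p : C => W p) (fun p => R p) (fun p => φ p) (fun p => hR p) (fun p => hφ p)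
  refine ⟨G, j1, j2, Q, π, hQ, hπ, fun x x' hxx => ?_⟩
  by_contra hcon
  have hmem : (x, x') ∈ ⋃ p : I, {q : X × X | φ p q.1 ≠ φ p q.2} :=
    Set.mem_iUnion.2 ⟨⟨(x, x'), hcon⟩, hne ⟨(x, x'), hcon⟩⟩
  rw [← hCU] at hmem
  simp only [Set.mem_iUnion] at hmem
  obtain ⟨p, hp, hpx⟩ := hmem
  exact hpx (h x x' hxx ⟨p, hp⟩)

end MaximalEquicontinuousFactor

/-! ### Affine maps between rotations, and factorization through rotations. -/

section Rotations

variable {Z W : Type u} [TopologicalSpace Z] [AddCommGroup Z] [IsTopologicalAddGroup Z]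
  [TopologicalSpace W] [AddCommGroup W] [IsTopologicalAddGroup W]

theorem IsMinimalSystem.denseRange_zsmul {θ : Z} (h : IsMinimalSystem (Homeomorph.addRight θ)) :
    DenseRange fun n : ℤ => n • θ := by
  have := h.2 0
  simp only [addRight_zpow_apply, zero_add] at this
  exact this

/-- A continuous map intertwining two rotations is affine if the first rotation is minimal. -/
theorem exists_addMonoidHom_of_semiconj [T2Space W] {θ : Z} {w : W}
    (hθ : DenseRange fun n : ℤ => n • θ) {η : Z → W} (hc : Continuous η)
    (hη : Function.Semiconj η (Homeomorph.addRight θ) (Homeomorph.addRight w)) :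
    ∃ h : Z →+ W, Continuous h ∧ h θ = w ∧ ∀ z, η z = h z + η 0 := by
  have key : ∀ (n : ℤ) (y : Z), η (y + n • θ) = η y + n • w := fun n y => by
    simpa only [addRight_zpow_apply] using semiconj_zpow hη n y
  have hadd : ∀ x y, η (x + y) = η x + η y - η 0 := by
    intro x y
    -- For fixed `y` both sides are continuous in `x`, so it suffices to compare them at multiples
    -- of `θ`.
    have := hθ.equalizer (g := fun x => η (x + y)) (h := fun x => η x + η y - η 0)
      (by fun_prop) (by fun_prop) (funext fun n => by
        have h1 := key n y
        have h2 := key n 0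
        rw [zero_add] at h2
        simp only [Function.comp]
        rw [add_comm, h1, h2]
        abel)
    exact congrFun this x
  refine ⟨AddMonoidHom.mk' (fun z => η z - η 0) fun x y => ?_, ?_, ?_, fun z => ?_⟩
  · rw [hadd]; abel
  · change Continuous fun z => η z - η 0
    fun_prop
  · have := key 1 0
    simp only [one_smul, zero_add] at this
    simp [this]
  · simp

end Rotations

theorem IsFactorMap.exists_factor {X G W : Type u} [TopologicalSpace X] [CompactSpace X]
    [TopologicalSpace G] [T2Space G] [TopologicalSpace W] {T : X ≃ₜ X} {R : G ≃ₜ G} {Q : W ≃ₜ W}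
    {π : X → G} {φ : X → W} (hπ : IsFactorMap T R π) (hφ : IsFactorMap T Q φ)
    (h : ∀ x x', π x = π x' → φ x = φ x') : ∃ f : G → W, IsFactorMap R Q f ∧ φ = f ∘ π := by
  obtain ⟨s, hs⟩ := hπ.surjective.hasRightInverse
  have hf : φ = (φ ∘ s) ∘ π := funext fun x => h _ _ (hs (π x)).symm
  refine ⟨φ ∘ s, ⟨?_, ?_, fun g => ?_⟩, hf⟩
  · have hq := hπ.continuous.isClosedMap.isQuotientMap hπ.continuous hπ.surjective
    rw [hq.continuous_iff, ← hf]
    exact hφ.continuous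
  · intro w
    obtain ⟨x, rfl⟩ := hφ.surjective w
    exact ⟨π x, (congrFun hf x).symm⟩
  · obtain ⟨x, rfl⟩ := hπ.surjective g
    rw [← hπ.semiconj]
    have h1 := congrFun hf x
    have h2 := congrFun hf (T x)
    simp only [Function.comp] at h1 h2 ⊢
    rw [← h2, ← h1, hφ.semiconj]

/-- The map `π` onto a rotation of a compact abelian group realizes the maximal equicontinuous
factor of `(X, T)`. -/
structure IsMaxEquicontinuousRotation {X G : Type u} [MetricSpace X] [MetricSpace G]
    [AddCommGroup G] [IsTopologicalAddGroup G] (T : X ≃ₜ X) (a : G) (π : X → G) : Prop where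
  factor : IsFactorMap T (Homeomorph.addRight a) π
  rel : ∀ x x', π x = π x' → equicontinuousSetoid T x x'
  dense : DenseRange fun n : ℤ => n • a

theorem exists_isMaxEquicontinuousRotation {X : Type u} [MetricSpace X] [CompactSpace X]
    {T : X ≃ₜ X} (hT : IsMinimalSystem T) :
    ∃ (G : Type u) (_ : MetricSpace G) (_ : CompactSpace G) (_ : AddCommGroup G)
      (_ : IsTopologicalAddGroup G) (a : G) (π : X → G), IsMaxEquicontinuousRotation T a π := by
  obtain ⟨G, i1, i2, Q, π, hQ, hπ, h⟩ := exists_maximal_equicontinuous_factor T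
  obtain ⟨j1, j2, a, rfl⟩ := exists_eq_addRight hQ (hT.factor hπ)
  exact ⟨G, i1, i2, j1, j2, a, π, hπ, h, (hT.factor hπ).denseRange_zsmul⟩

/-! ### The common quotient of two rotations. -/

section CommonFactor

variable {G H : Type u} [TopologicalSpace G] [AddCommGroup G] [IsTopologicalAddGroup G]
  [TopologicalSpace H] [AddCommGroup H] [IsTopologicalAddGroup H]

/-- The closed subgroup generated by `(a, b)`. -/
def diagonalClosure (a : G) (b : H) : AddSubgroup (G × H) :=
  (AddSubgroup.zmultiples (a, b)).topologicalClosure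

/-- The quotient of `G × H` by the closed subgroup generated by `(a, b)`. -/
abbrev CommonQuotient (a : G) (b : H) : Type u := (G × H) ⧸ diagonalClosure a b

namespace CommonQuotient

variable (a : G) (b : H)

/-- The homomorphism `g ↦ [(g, 0)]`. -/
def inl : G →+ CommonQuotient a b :=
  (QuotientAddGroup.mk' (diagonalClosure a b)).comp (AddMonoidHom.inl G H)

/-- The homomorphism `h ↦ -[(0, h)]`. -/
def inr : H →+ CommonQuotient a b :=
  -(QuotientAddGroup.mk' (diagonalClosure a b)).comp (AddMonoidHom.inr G H)

theorem continuous_inl : Continuous (inl a b) :=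
  (QuotientAddGroup.continuous_mk (N := diagonalClosure a b)).comp
    (by fun_prop : Continuous fun g : G => (g, (0 : H)))

theorem continuous_inr : Continuous (inr a b) :=
  ((QuotientAddGroup.continuous_mk (N := diagonalClosure a b)).comp
    (by fun_prop : Continuous fun h : H => ((0 : G), h))).neg

/-- This explains the sign in `inr`: the difference map is the quotient projection, so its fibers
are cosets. -/
theorem inl_sub_inr (g : G) (h : H) :
    inl a b g - inr a b h = QuotientAddGroup.mk' (diagonalClosure a b) (g, h) := by
  simp only [inl, inr, AddMonoidHom.neg_apply, sub_neg_eq_add, AddMonoidHom.comp_apply, ← map_add]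
  simp

theorem inl_eq_inr : inl a b a = inr a b b := by
  rw [← sub_eq_zero, inl_sub_inr]
  exact (QuotientAddGroup.eq_zero_iff _).2
    (AddSubgroup.le_topologicalClosure _ (AddSubgroup.mem_zmultiples _))

variable {a b}

/-- Modulo `(a, b)` the pair `(g, n • b)` equals `(g - n • a, 0)`. Density of the multiples of `b`
and closedness of the compact range give the rest. -/
theorem inl_surjective [CompactSpace G] [T2Space (CommonQuotient a b)]
    (hb : DenseRange fun n : ℤ => n • b) : Function.Surjective (inl a b) := by
  have hcl : IsClosed (Set.range (inl a b)) := (isCompact_range (continuous_inl a b)).isClosed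
  intro z
  obtain ⟨⟨g, h⟩, rfl⟩ := QuotientAddGroup.mk'_surjective _ z
  rw [← inl_sub_inr]
  refine hb.induction_on (p := fun h => inl a b g - inr a b h ∈ Set.range (inl a b)) h
    (hcl.preimage (by have := continuous_inr a b; fun_prop)) fun n => ?_
  refine ⟨g - n • a, ?_⟩
  rw [map_sub, map_zsmul, map_zsmul, inl_eq_inr]

theorem inr_surjective [CompactSpace H] [T2Space (CommonQuotient a b)]
    (ha : DenseRange fun n : ℤ => n • a) : Function.Surjective (inr a b) := by
  have hcl : IsClosed (Set.range (inr a b)) := (isCompact_range (continuous_inr a b)).isClosed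
  intro z
  obtain ⟨⟨g, h⟩, rfl⟩ := QuotientAddGroup.mk'_surjective _ z
  rw [← inl_sub_inr]
  refine ha.induction_on (p := fun g => inl a b g - inr a b h ∈ Set.range (inr a b)) g
    (hcl.preimage (by have := continuous_inl a b; fun_prop)) fun n => ?_
  refine ⟨n • b - h, ?_⟩
  rw [map_sub, map_zsmul, map_zsmul, inl_eq_inr]

instance : T3Space (CommonQuotient a b) := by
  have : IsClosed (diagonalClosure a b : Set (G × H)) :=
    AddSubgroup.isClosed_topologicalClosure _
  infer_instance

theorem isFactorMap_inl [CompactSpace G] (hb : DenseRange fun n : ℤ => n • b) :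
    IsFactorMap (Homeomorph.addRight a) (Homeomorph.addRight (inl a b a)) (inl a b) :=
  ⟨continuous_inl a b, inl_surjective hb, fun g => map_add (inl a b) g a⟩

theorem isFactorMap_inr [CompactSpace H] (ha : DenseRange fun n : ℤ => n • a) :
    IsFactorMap (Homeomorph.addRight b) (Homeomorph.addRight (inl a b a)) (inr a b) :=
  ⟨continuous_inr a b, inr_surjective ha, fun h => by
    rw [inl_eq_inr]; exact map_add (inr a b) h b⟩

/-- Any two homomorphisms that agree on the generators factor through the common quotient. -/
theorem exists_lift {W : Type u} [TopologicalSpace W] [T2Space W] [AddCommGroup W]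
    [IsTopologicalAddGroup W] {f : G →+ W} {g : H →+ W} (hf : Continuous f) (hg : Continuous g)
    (hfg : f a = g b) :
    ∃ k : CommonQuotient a b →+ W, Continuous k ∧ (∀ x, k (inl a b x) = f x) ∧
      ∀ y, k (inr a b y) = g y := by
  let F : G × H →+ W := f.comp (AddMonoidHom.fst G H) - g.comp (AddMonoidHom.snd G H)
  have hFapp : ∀ p : G × H, F p = f p.1 - g p.2 := fun _ => rfl
  have hF : Continuous F := by
    change Continuous fun p : G × H => f p.1 - g p.2
    fun_prop
  have hker : diagonalClosure a b ≤ F.ker := by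
    refine AddSubgroup.topologicalClosure_minimal _ ?_ ?_
    · rw [AddSubgroup.zmultiples_le]
      change F (a, b) = 0
      rw [hFapp, hfg, sub_self]
    · exact isClosed_singleton.preimage hF
  refine ⟨QuotientAddGroup.lift _ F hker, ?_, fun x => ?_, fun y => ?_⟩
  · exact (QuotientAddGroup.isQuotientMap_mk (N := diagonalClosure a b)).continuous_iff.2 hF
  · change F (x, 0) = f x
    simp [hFapp]
  · rw [inr, AddMonoidHom.neg_apply, map_neg]
    change -F (0, y) = g y
    simp [hFapp]

end CommonQuotient

end CommonFactor

noncomputable instance CommonQuotient.instMetricSpace {G H : Type u} [MetricSpace G]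
    [CompactSpace G] [AddCommGroup G] [IsTopologicalAddGroup G] [MetricSpace H] [CompactSpace H]
    [AddCommGroup H] [IsTopologicalAddGroup H] (a : G) (b : H) :
    MetricSpace (CommonQuotient a b) :=
  have := TopologicalSpace.metrizableSpace_of_t3_secondCountable (CommonQuotient a b)
  TopologicalSpace.metrizableSpaceMetric (CommonQuotient a b)

theorem IsMaxEquicontinuousRotation.exists_affine {X G W : Type u} [MetricSpace X]
    [CompactSpace X] {T : X ≃ₜ X} [MetricSpace G] [AddCommGroup G] [IsTopologicalAddGroup G]
    [MetricSpace W] [CompactSpace W] [AddCommGroup W] [IsTopologicalAddGroup W] {a : G} {π : X → G}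
    {w : W} {φ : X → W}
    (hπ : IsMaxEquicontinuousRotation T a π) (hφ : IsFactorMap T (Homeomorph.addRight w) φ) :
    ∃ (f : G →+ W) (c : W), Continuous f ∧ f a = w ∧ ∀ x, φ x = f (π x) + c := by
  obtain ⟨f, hf, hfφ⟩ := hπ.factor.exists_factor hφ fun x x' h =>
    hπ.rel x x' h W _ φ (isEquicontinuousSystem_addRight w) hφ
  obtain ⟨f₀, hf₀, hfa, hff⟩ := exists_addMonoidHom_of_semiconj hπ.dense hf.continuous hf.semiconj
  exact ⟨f₀, f 0, hf₀, hfa, fun x => by rw [hfφ, Function.comp, hff]⟩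

-- Maximality of `Z` yields two maps to the common quotient. Both are affine with the same linear
-- part, since both linear parts send `θ` to `inl a b a`. Hence the coset of `(π x, ρ y)` depends
-- only on `α x - β y`.
open CommonQuotient in
theorem IsMaxCommonEquicontinuousFactor.sub_mem_diagonalClosure
    {X Y G H : Type u} [MetricSpace X] [MetricSpace Y] {T : X ≃ₜ X} {S : Y ≃ₜ Y} [MetricSpace G]
    [CompactSpace G] [AddCommGroup G] [IsTopologicalAddGroup G] [MetricSpace H] [CompactSpace H]
    [AddCommGroup H] [IsTopologicalAddGroup H] {a : G} {b : H} {π : X → G} {ρ : Y → H}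
    {Z : Type u} [MetricSpace Z] [CompactSpace Z]
    [AddCommGroup Z] [IsTopologicalAddGroup Z] {θ : Z} {α : X → Z} {β : Y → Z}
    (hZ : IsMaxCommonEquicontinuousFactor T S (Homeomorph.addRight θ) α β) (hT : IsMinimalSystem T)
    (hπ : IsMaxEquicontinuousRotation T a π) (hρ : IsMaxEquicontinuousRotation S b ρ)
    {x x' : X} {y y' : Y} (h : α x - β y = α x' - β y') :
    (π x' - π x, ρ y' - ρ y) ∈ diagonalClosure a b := by
  have hθ := (hT.factor hZ.left).denseRange_zsmul
  obtain ⟨η₁, η₂, h₁, h₂, hα, hβ⟩ := hZ.maximal (CommonQuotient a b) _ _ _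
    (isEquicontinuousSystem_addRight (inl a b a)) ((isFactorMap_inl hρ.dense).comp hπ.factor)
    ((isFactorMap_inr hπ.dense).comp hρ.factor)
  obtain ⟨k₁, hk₁, hkθ₁, hη₁⟩ := exists_addMonoidHom_of_semiconj hθ h₁.continuous h₁.semiconj
  obtain ⟨k₂, hk₂, hkθ₂, hη₂⟩ := exists_addMonoidHom_of_semiconj hθ h₂.continuous h₂.semiconj
  have hk : (k₁ : Z → CommonQuotient a b) = k₂ :=
    hθ.equalizer hk₁ hk₂ (funext fun n => by
      simp only [Function.comp, map_zsmul, hkθ₁, hkθ₂])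
  have key : ∀ (x : X) (y : Y), QuotientAddGroup.mk' (diagonalClosure a b) (π x, ρ y) =
      k₁ (α x - β y) + (η₁ 0 - η₂ 0) := fun x y => by
    have e₁ := congrFun hα x
    have e₂ := congrFun hβ y
    simp only [Function.comp] at e₁ e₂
    rw [← inl_sub_inr, e₁, e₂, hη₁, hη₂, ← hk, map_sub]
    abel
  have := (key x y).trans ((congrArg (fun z => k₁ z + (η₁ 0 - η₂ 0)) h).trans (key x' y').symm)
  have h3 := (QuotientAddGroup.eq (s := diagonalClosure a b)).1 this
  simpa [Prod.ext_iff, sub_eq_neg_add] using h3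

/-! ### Maximality of the common quotient, and projections of invariant sets. -/

section MaximalCommonFactor

variable {X Y G H : Type u} [MetricSpace X] [CompactSpace X] [MetricSpace Y] [CompactSpace Y]
  {T : X ≃ₜ X} {S : Y ≃ₜ Y} [MetricSpace G] [CompactSpace G] [AddCommGroup G]
  [IsTopologicalAddGroup G] [MetricSpace H] [CompactSpace H] [AddCommGroup H]
  [IsTopologicalAddGroup H] {a : G} {b : H} {π : X → G} {ρ : Y → H}

open CommonQuotient

theorem isMaxCommonEquicontinuousFactor_commonQuotient (hT : IsMinimalSystem T)
    (hπ : IsMaxEquicontinuousRotation T a π) (hρ : IsMaxEquicontinuousRotation S b ρ) :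
    IsMaxCommonEquicontinuousFactor T S (Homeomorph.addRight (inl a b a)) (inl a b ∘ π)
      (inr a b ∘ ρ) := by
  refine ⟨isEquicontinuousSystem_addRight _, (isFactorMap_inl hρ.dense).comp hπ.factor,
    (isFactorMap_inr hπ.dense).comp hρ.factor, ?_⟩
  intro W _ _ Q φ ψ hQ hφ hψ
  obtain ⟨_, _, w, rfl⟩ := exists_eq_addRight hQ (hT.factor hφ)
  obtain ⟨f, c, hf, hfa, hfφ⟩ := hπ.exists_affine hφ
  obtain ⟨g, d, hg, hgb, hgψ⟩ := hρ.exists_affine hψ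
  obtain ⟨k, hk, hkf, hkg⟩ := exists_lift hf hg (hfa.trans hgb.symm)
  -- One homomorphism `k` serves both sides; only the constants `c` and `d` differ, which is why two
  -- maps from the common factor are needed.
  have hφk : φ = (fun z => k z + c) ∘ (inl a b ∘ π) :=
    funext fun x => by simp only [Function.comp, hkf, hfφ]
  have hψk : ψ = (fun z => k z + d) ∘ (inr a b ∘ ρ) :=
    funext fun x => by simp only [Function.comp, hkg, hgψ]
  have hsemi : ∀ e : W, Function.Semiconj (fun z => k z + e)
      (Homeomorph.addRight (inl a b a)) (Homeomorph.addRight w) := fun e z => by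
    simp only [Homeomorph.coe_addRight, map_add, hkf, hfa]
    abel
  refine ⟨_, _, ⟨hk.add continuous_const, ?_, hsemi c⟩, ⟨hk.add continuous_const, ?_, hsemi d⟩,
    hφk, hψk⟩
  · exact Function.Surjective.of_comp (hφk ▸ hφ.surjective)
  · exact Function.Surjective.of_comp (hψk ▸ hψ.surjective)

theorem IsMaxCommonEquicontinuousFactor.image_proj_eq_univ {Z : Type u} [MetricSpace Z]
    [CompactSpace Z] [AddCommGroup Z] [IsTopologicalAddGroup Z] {θ : Z} {α : X → Z} {β : Y → Z}
    (hZ : IsMaxCommonEquicontinuousFactor T S (Homeomorph.addRight θ) α β) (hT : IsMinimalSystem T)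
    (hS : IsMinimalSystem S) {J : Set (X × Y)} (hJc : IsClosed J) (hJ : T.prodCongr S '' J = J)
    (hJZ : (fun p : X × Y => α p.1 - β p.2) '' J = Set.univ) :
    Prod.map (maxEquicontinuousProj T) (maxEquicontinuousProj S) '' J = Set.univ := by
  obtain ⟨G, _, _, _, _, a, π, hπ⟩ := exists_isMaxEquicontinuousRotation hT
  obtain ⟨H, _, _, _, _, b, ρ, hρ⟩ := exists_isMaxEquicontinuousRotation hS
  refine Set.eq_univ_of_forall ?_
  rintro ⟨q, r⟩
  obtain ⟨x, rfl⟩ := Quotient.exists_rep q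
  obtain ⟨y, rfl⟩ := Quotient.exists_rep r
  obtain ⟨⟨x₁, y₁⟩, h₁, hxy⟩ : α x - β y ∈ (fun p : X × Y => α p.1 - β p.2) '' J :=
    hJZ ▸ Set.mem_univ _
  have hmem := hZ.sub_mem_diagonalClosure hT hπ hρ hxy
  -- Recentering at `(x₁, y₁)` sends its orbit to the multiples of `(a, b)`, so the compact image of
  -- `J` contains their closure.
  let Φ : X × Y → G × H := fun p => (π p.1 - π x₁, ρ p.2 - ρ y₁)
  have hΦ : Continuous Φ := by
    have := hπ.factor.continuous
    have := hρ.factor.continuous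
    fun_prop
  have hcl : IsClosed (Φ '' J) := (hJc.isCompact.image hΦ).isClosed
  have hsub : (diagonalClosure a b : Set (G × H)) ⊆ Φ '' J := by
    rw [diagonalClosure, AddSubgroup.topologicalClosure_coe]
    refine closure_minimal ?_ hcl
    rintro _ ⟨n, rfl⟩
    refine ⟨_, zpow_mem hJ n h₁, ?_⟩
    simp only [Φ, prodCongr_zpow_apply, semiconj_zpow hπ.factor.semiconj,
      semiconj_zpow hρ.factor.semiconj, addRight_zpow_apply]
    simp
  obtain ⟨⟨x₂, y₂⟩, h₂, he⟩ := hsub hmem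
  simp only [Φ, Prod.mk.injEq, sub_left_inj] at he
  exact ⟨(x₂, y₂), h₂, Prod.ext (Quotient.sound (hπ.rel _ _ he.1))
    (Quotient.sound (hρ.rel _ _ he.2))⟩

end MaximalCommonFactor

/-! ### Minimal subsets, joinings and the fibers of `γ`. -/

theorem HasUniqueMinimalSubset.of_forall_dense {X : Type u} [TopologicalSpace X] {F : X ≃ₜ X}
    {A : Set X} (hc : IsClosed A) (hne : A.Nonempty) (hA : F '' A = A)
    (h : ∀ p ∈ A, A ⊆ orbitClosure F p) : HasUniqueMinimalSubset F A := by
  refine ⟨A, ⟨subset_rfl, hne, hc, hA, h⟩, ?_⟩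
  rintro M ⟨hMA, hM⟩
  obtain ⟨p, hp⟩ := hM.nonempty
  exact hMA.antisymm ((h p (hMA hp)).trans (orbitClosure_subset hM.isClosed hM.invariant hp))

/-- Applied to `T ^ m × S ^ n`, which commutes with `T × S`, this moves minimal sets from one fiber
of `γ` to another. -/
theorem isMinimalSubset_image {X : Type u} [TopologicalSpace X] {F E : X ≃ₜ X}
    (hEF : ∀ p, E (F p) = F (E p)) {M : Set X} (hM : IsMinimalSubset F M) :
    IsMinimalSubset F (E '' M) := by
  refine ⟨hM.nonempty.image _, E.isClosed_image.2 hM.isClosed, ?_, ?_⟩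
  · rw [Set.image_image]
    simp only [← hEF]
    rw [← Set.image_image, hM.invariant]
  · rintro _ ⟨p, hp, rfl⟩
    refine (Set.image_mono (hM.dense_orbit p hp)).trans ?_
    rw [E.image_closure, ← Set.range_comp]
    refine closure_mono ?_
    rintro _ ⟨n, rfl⟩
    exact ⟨n, (semiconj_zpow hEF n p).symm⟩

theorem isJoining_of_nonempty {X Y : Type u} [MetricSpace X] [CompactSpace X] [MetricSpace Y]
    [CompactSpace Y] {T : X ≃ₜ X} {S : Y ≃ₜ Y} (hT : IsMinimalSystem T) (hS : IsMinimalSystem S)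
    {J : Set (X × Y)} (hc : IsClosed J) (hJ : T.prodCongr S '' J = J) (hne : J.Nonempty) : IsJoining T S J := by
  refine ⟨hc, hJ, ?_, ?_⟩
  · refine hT.eq_univ (hc.isCompact.image continuous_fst).isClosed ?_ (hne.image _)
    conv_rhs => rw [← hJ]
    rw [Set.image_image, Set.image_image]
    rfl
  · refine hS.eq_univ (hc.isCompact.image continuous_snd).isClosed ?_ (hne.image _)
    conv_rhs => rw [← hJ]
    rw [Set.image_image, Set.image_image]
    rfl

theorem sub_surjective {X Y Z : Type u} [AddGroup Z] {α : X → Z} {β : Y → Z}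
    (hα : Function.Surjective α) (hβ : Function.Surjective β) :
    Function.Surjective (fun p : X × Y => α p.1 - β p.2) := by
  intro z
  obtain ⟨y, hy⟩ := hβ 0
  obtain ⟨x, rfl⟩ := hα z
  exact ⟨(x, y), by simp [hy]⟩

section Fibers

variable {X Y Z : Type u} [TopologicalSpace X] [TopologicalSpace Y] {T : X ≃ₜ X} {S : Y ≃ₜ Y}
  [TopologicalSpace Z] [AddCommGroup Z] [IsTopologicalAddGroup Z] {θ : Z} {α : X → Z} {β : Y → Z}

/-- The case `m = n` gives invariance of the fibers; unequal exponents permute them by multiples of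
`θ`. -/
theorem sub_zpow_apply (hα : IsFactorMap T (Homeomorph.addRight θ) α)
    (hβ : IsFactorMap S (Homeomorph.addRight θ) β) (m n : ℤ) (x : X) (y : Y) :
    α ((T ^ m) x) - β ((S ^ n) y) = α x - β y + (m - n) • θ := by
  rw [semiconj_zpow hα.semiconj, semiconj_zpow hβ.semiconj, addRight_zpow_apply,
    addRight_zpow_apply, sub_zsmul]
  abel

theorem sub_image_fiber (hα : IsFactorMap T (Homeomorph.addRight θ) α)
    (hβ : IsFactorMap S (Homeomorph.addRight θ) β) (A : Set Z) :
    T.prodCongr S '' ((fun p : X × Y => α p.1 - β p.2) ⁻¹' A) =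
      (fun p : X × Y => α p.1 - β p.2) ⁻¹' A := by
  refine image_eq_of_zpow_mem fun n p hp => ?_
  rw [prodCongr_zpow_apply]
  simpa [sub_zpow_apply hα hβ] using hp

theorem isClosed_fiber (hα : Continuous α) (hβ : Continuous β) {A : Set Z} (hA : IsClosed A) :
    IsClosed ((fun p : X × Y => α p.1 - β p.2) ⁻¹' A) :=
  hA.preimage (by fun_prop)

end Fibers

/-! ### Quasi-disjointness and unique minimal subsets in fibers. -/

section QuasiDisjoint

variable {X Y Z : Type u} [MetricSpace X] [CompactSpace X] [MetricSpace Y] [CompactSpace Y]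
  {T : X ≃ₜ X} {S : Y ≃ₜ Y} [MetricSpace Z] [CompactSpace Z] [AddCommGroup Z]
  [IsTopologicalAddGroup Z] {θ : Z} {α : X → Z} {β : Y → Z}

/-- A unique minimal subset in one fiber forces quasi-disjointness. -/
theorem quasiDisjoint_of_hasUniqueMinimalSubset (hT : IsMinimalSystem T) (hS : IsMinimalSystem S)
    (hα : IsFactorMap T (Homeomorph.addRight θ) α) (hβ : IsFactorMap S (Homeomorph.addRight θ) β)
    {z : Z} (hz : HasUniqueMinimalSubset (T.prodCongr S)
      ((fun p : X × Y => α p.1 - β p.2) ⁻¹' {z})) : QuasiDisjoint T S := by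
  intro J hJ hJproj
  obtain ⟨M, ⟨hMz, hM⟩, huniq⟩ := hz
  -- Since `Z` is equicontinuous, `α` and `β` are constant on the classes defining `X_eq` and
  -- `Y_eq`, so `γ` maps `J` onto `Z`.
  have hsurj : ∀ w : Z, ∃ p ∈ J, α p.1 - β p.2 = w := by
    intro w
    obtain ⟨⟨x, y⟩, hxy⟩ := sub_surjective hα.surjective hβ.surjective w
    obtain ⟨⟨x', y'⟩, hp, he⟩ : ((maxEquicontinuousProj T x, maxEquicontinuousProj S y) : _ × _) ∈
      Prod.map (maxEquicontinuousProj T) (maxEquicontinuousProj S) '' J := hJproj ▸ Set.mem_univ _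
    have h1 : equicontinuousSetoid T x' x := Quotient.exact (congrArg Prod.fst he)
    have h2 : equicontinuousSetoid S y' y := Quotient.exact (congrArg Prod.snd he)
    refine ⟨(x', y'), hp, ?_⟩
    have e1 := h1 Z _ α (isEquicontinuousSystem_addRight θ) hα
    have e2 := h2 Z _ β (isEquicontinuousSystem_addRight θ) hβ
    simp only [e1, e2]
    exact hxy
  let E : ℤ → ℤ → X × Y ≃ₜ X × Y := fun m n => (T ^ m).prodCongr (S ^ n)
  have hcomm : ∀ m n p, E m n (T.prodCongr S p) = T.prodCongr S (E m n p) := fun m n p =>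
    Prod.ext (DFunLike.congr_fun ((Commute.refl T).zpow_left m).eq p.1)
      (DFunLike.congr_fun ((Commute.refl S).zpow_left n).eq p.2)
  have hEM : ∀ m n, E m n '' M ⊆ J := by
    intro m n
    let B := (fun p : X × Y => α p.1 - β p.2) ⁻¹' {z + (m - n) • θ} ∩ J
    have hBi : T.prodCongr S '' B = B := by
      rw [Set.image_inter (T.prodCongr S).injective, sub_image_fiber hα hβ, hJ.invariant]
    obtain ⟨N, hNB, hN⟩ := exists_isMinimalSubset (T.prodCongr S) (A := B)
      ((isClosed_fiber hα.continuous hβ.continuous isClosed_singleton).inter hJ.isClosed) hBi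
      (by obtain ⟨p, hp, hpw⟩ := hsurj (z + (m - n) • θ); exact ⟨p, hpw, hp⟩)
    -- Uniqueness over `z` identifies the pulled-back `N` with `M`, so `E m n` carries `M` onto `N`,
    -- inside `J`.
    have hNM : E (-m) (-n) '' N = M := by
      refine huniq _ ⟨?_, isMinimalSubset_image (hcomm _ _) hN⟩
      rintro _ ⟨p, hp, rfl⟩
      have hpz : α p.1 - β p.2 = z + (m - n) • θ := (hNB hp).1
      change α ((T ^ (-m)) p.1) - β ((S ^ (-n)) p.2) = z
      rw [sub_zpow_apply hα hβ, hpz, add_assoc, ← add_zsmul]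
      simp
    rw [← hNM]
    rintro _ ⟨_, ⟨p, hp, rfl⟩, rfl⟩
    have : E m n (E (-m) (-n) p) = p :=
      Prod.ext (zpow_zpow_neg_apply T m p.1) (zpow_zpow_neg_apply S n p.2)
    rw [this]
    exact (hNB hp).2
  obtain ⟨⟨x, y⟩, hxy⟩ := hM.nonempty
  have hd : Dense ((Set.range fun m : ℤ => (T ^ m) x) ×ˢ (Set.range fun n : ℤ => (S ^ n) y)) :=
    (hT.2 x).prod (hS.2 y)
  apply Set.eq_univ_of_univ_subset
  rw [← hd.closure_eq]
  refine closure_minimal ?_ hJ.isClosed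
  rintro ⟨_, _⟩ ⟨⟨m, rfl⟩, ⟨n, rfl⟩⟩
  exact hEM m n ⟨(x, y), hxy, rfl⟩

/-- If `(X, T)` and `(Y, S)` are quasi-disjoint then, for every nonempty open set, there is a
fiber all of whose orbits meet it. -/
theorem QuasiDisjoint.exists_fiber_subset (h : QuasiDisjoint T S) (hT : IsMinimalSystem T)
    (hS : IsMinimalSystem S)
    (hZ : IsMaxCommonEquicontinuousFactor T S (Homeomorph.addRight θ) α β)
    {U : Set (X × Y)} (hU : IsOpen U) (hne : U.Nonempty) :
    ∃ z : Z, (fun p : X × Y => α p.1 - β p.2) ⁻¹' {z} ⊆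
      ⋃ n : ℤ, ⇑((T.prodCongr S) ^ n) ⁻¹' U := by
  by_contra! hcon
  let J : Set (X × Y) := (⋃ n : ℤ, ⇑((T.prodCongr S) ^ n) ⁻¹' U)ᶜ
  have hmemJ : ∀ p, p ∈ J ↔ ∀ n : ℤ, ((T.prodCongr S) ^ n) p ∉ U := fun p => by simp [J]
  have hJc : IsClosed J :=
    (isOpen_iUnion fun n => hU.preimage (Homeomorph.continuous _)).isClosed_compl
  have hJi : T.prodCongr S '' J = J := image_eq_of_zpow_mem fun n p hp => by
    rw [hmemJ] at hp ⊢
    intro m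
    rw [← zpow_add_apply]
    exact hp _
  have hJZ : (fun p : X × Y => α p.1 - β p.2) '' J = Set.univ := by
    refine Set.eq_univ_of_forall fun z => ?_
    obtain ⟨p, hp, hpU⟩ := Set.not_subset.1 (hcon z)
    exact ⟨p, hpU, hp⟩
  obtain ⟨p, hp⟩ := hne
  have hJne : J.Nonempty := Set.image_nonempty.1 (hJZ ▸ ⟨α p.1, Set.mem_univ _⟩ :
    ((fun p : X × Y => α p.1 - β p.2) '' J).Nonempty)
  have := h J (isJoining_of_nonempty hT hS hJc hJi hJne)
    (hZ.image_proj_eq_univ hT hS hJc hJi hJZ)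
  exact (hmemJ p).1 (this ▸ Set.mem_univ p) 0 hp

/-- For quasi-disjoint systems the generic fiber of `(x, y) ↦ α x - β y` is minimal. -/
theorem QuasiDisjoint.exists_isGδ_dense (h : QuasiDisjoint T S) (hT : IsMinimalSystem T)
    (hS : IsMinimalSystem S)
    (hZ : IsMaxCommonEquicontinuousFactor T S (Homeomorph.addRight θ) α β) :
    ∃ Ω : Set Z, IsGδ Ω ∧ Dense Ω ∧ ∀ z ∈ Ω, HasUniqueMinimalSubset (T.prodCongr S)
      ((fun p : X × Y => α p.1 - β p.2) ⁻¹' {z}) := by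
  set γ : X × Y → Z := fun p => α p.1 - β p.2 with hγ
  have hα := hZ.left
  have hβ := hZ.right
  have hγc : Continuous γ := by
    have := hα.continuous
    have := hβ.continuous
    fun_prop
  let V : Set (X × Y) → Set (X × Y) := fun U => ⋃ n : ℤ, ⇑((T.prodCongr S) ^ n) ⁻¹' U
  have hV : ∀ U, IsOpen U → IsOpen (V U) := fun U hU =>
    isOpen_iUnion fun n => hU.preimage (Homeomorph.continuous _)
  -- Over a point of `D U`, either every orbit in the fiber meets `U` or the fiber misses `U`.
  -- Taking the closure of `γ '' U` makes the second condition open.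
  let D : Set (X × Y) → Set Z := fun U => (γ '' (V U)ᶜ)ᶜ ∪ (closure (γ '' U))ᶜ
  have hDo : ∀ U, IsOpen U → IsOpen (D U) := fun U hU =>
    (((hV U hU).isClosed_compl.isCompact.image hγc).isClosed.isOpen_compl).union
      isClosed_closure.isOpen_compl
  have hDd : ∀ U, IsOpen U → Dense (D U) := by
    intro U hU
    rw [dense_iff_inter_open]
    intro A hA hAne
    by_cases hAU : (U ∩ γ ⁻¹' A).Nonempty
    -- Intersecting `U` with `γ ⁻¹' A` forces `z ∈ A`, because `γ` is constant on orbits.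
    · obtain ⟨z, hz⟩ := h.exists_fiber_subset hT hS hZ (hU.inter (hA.preimage hγc)) hAU
      obtain ⟨p, hp⟩ := sub_surjective hα.surjective hβ.surjective z
      refine ⟨z, ?_, Or.inl ?_⟩
      · obtain ⟨n, hn⟩ := Set.mem_iUnion.1 (hz hp)
        have h2 : γ (((T.prodCongr S) ^ n) p) ∈ A := hn.2
        rw [prodCongr_zpow_apply] at h2
        simp only [hγ, sub_zpow_apply hα hβ, sub_self, zero_smul, add_zero] at h2
        exact hp ▸ h2
      · rintro ⟨q, hq, hqz⟩
        obtain ⟨n, hn⟩ := Set.mem_iUnion.1 (hz hqz)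
        exact hq (Set.mem_iUnion.2 ⟨n, hn.1⟩)
    · obtain ⟨z, hz⟩ := hAne
      refine ⟨z, hz, Or.inr fun hcl => ?_⟩
      obtain ⟨_, hA', q, hq, rfl⟩ := mem_closure_iff.1 hcl A hA hz
      exact hAU ⟨q, hq, hA'⟩
  let 𝓑 := TopologicalSpace.countableBasis (X × Y)
  have h𝓑 := TopologicalSpace.isBasis_countableBasis (X × Y)
  have h𝓑c : 𝓑.Countable := TopologicalSpace.countable_countableBasis (X × Y)
  refine ⟨⋂ U ∈ 𝓑, D U, .biInter h𝓑c fun U hU => (hDo U (h𝓑.isOpen hU)).isGδ,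
    dense_biInter_of_isOpen (fun U hU => hDo U (h𝓑.isOpen hU)) h𝓑c
      fun U hU => hDd U (h𝓑.isOpen hU), fun z hz => ?_⟩
  refine HasUniqueMinimalSubset.of_forall_dense
    (isClosed_fiber hα.continuous hβ.continuous isClosed_singleton)
    (sub_surjective hα.surjective hβ.surjective z) (sub_image_fiber hα hβ _) ?_
  intro p hp q hq
  refine h𝓑.mem_closure_iff.2 fun U hU hqU => ?_
  rcases Set.mem_iInter₂.1 hz U hU with hzU | hzU
  · by_contra hcon
    refine hzU ⟨p, fun hpV => hcon ?_, hp⟩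
    obtain ⟨n, hn⟩ := Set.mem_iUnion.1 hpV
    exact ⟨_, hn, n, rfl⟩
  · exact (hzU (subset_closure ⟨q, hqU, hq⟩)).elim

end QuasiDisjoint

end TopDyn

theorem theorem1p1 {X Y : Type u} [MetricSpace X] [CompactSpace X] [MetricSpace Y] [CompactSpace Y]
    (T : X ≃ₜ X) (S : Y ≃ₜ Y)
    (hT : TopDyn.IsMinimalSystem T) (hS : TopDyn.IsMinimalSystem S) :
    -- the maximal common equicontinuous factor exists, as a rotation of a compact abelian group
    (∃ (Z : Type u) (_ : MetricSpace Z) (_ : CompactSpace Z) (_ : AddCommGroup Z)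
      (_ : IsTopologicalAddGroup Z) (θ : Z) (α : X → Z) (β : Y → Z),
      TopDyn.IsMaxCommonEquicontinuousFactor T S (Homeomorph.addRight θ) α β) ∧
    -- and for each of its realizations the three assertions are equivalent
    (∀ (Z : Type u) [MetricSpace Z] [CompactSpace Z] [AddCommGroup Z]
      [IsTopologicalAddGroup Z] (θ : Z) (α : X → Z) (β : Y → Z),
      TopDyn.IsMaxCommonEquicontinuousFactor T S (Homeomorph.addRight θ) α β →
      List.TFAE [
        ∃ z : Z, TopDyn.HasUniqueMinimalSubset (T.prodCongr S)
          ((fun p : X × Y => α p.1 - β p.2) ⁻¹' {z}),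
        ∃ Ω : Set Z, IsGδ Ω ∧ Dense Ω ∧ ∀ z ∈ Ω, TopDyn.HasUniqueMinimalSubset (T.prodCongr S)
          ((fun p : X × Y => α p.1 - β p.2) ⁻¹' {z}),
        TopDyn.QuasiDisjoint T S]) := by
  constructor
  · obtain ⟨G, _, _, _, _, a, π, hπ⟩ := TopDyn.exists_isMaxEquicontinuousRotation hT
    obtain ⟨H, _, _, _, _, b, ρ, hρ⟩ := TopDyn.exists_isMaxEquicontinuousRotation hS
    exact ⟨TopDyn.CommonQuotient a b, inferInstance, inferInstance, inferInstance, inferInstance,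
      _, _, _, TopDyn.isMaxCommonEquicontinuousFactor_commonQuotient hT hπ hρ⟩
  · intro Z _ _ _ _ θ α β hZ
    tfae_have 1 → 3 := fun ⟨z, hz⟩ =>
      TopDyn.quasiDisjoint_of_hasUniqueMinimalSubset hT hS hZ.left hZ.right hz
    tfae_have 3 → 2 := fun h => h.exists_isGδ_dense hT hS hZ
    tfae_have 2 → 1 := fun ⟨Ω, _, hd, h⟩ => by
      have := hT.1.map α
      obtain ⟨z, hz⟩ := hd.nonempty
      exact ⟨z, h z hz⟩
    tfae_finish
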